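/- Let $P$ be the set of positive integers ordered by reverse divisibility ($m \le n$ in $P$ if and only if $n \mid m$), regarded as a category with a unique morphism $m \to n$ whenever $m \le n$. Let $X$ be the set of filters on $P$ (nonempty, downward directed, upward closed subsets), ordered by inclusion. Then $X$ is isomorphic to the poset $\mathbb{S}$ of supernatural numbers (formal products $\prod_q q^{e_q}$ over all primes $q$, with $e_q \in \{0,1,2,\dots,\infty\}$) under divisibility, by an order isomorphism that sends the principal filter $\{m : m \mid n\}$ of $n \in P$ to $n = \prod_q q^{v_q(n)}$. The subtoposes of the presheaf topos $\mathsf{PSh}(P)$ are the sheaf toposes $\mathsf{Sh}(P,J)$ for the Grothendieck topologies $J$ on $P$. Let - $\mathbf{x}$ be the cardinality of $X$; - $\mathbf{cl}$ be the cardinality of the set of closed subtoposes of $\mathsf{PSh}(P)$, i.e. of the $J$ such that for some subterminal presheaf $U$ the $J$-sheaves are exactly the presheaves $F$ for which the projection $F \times U \to U$ is an isomorphism; - $\mathbf{coh}$ be the cardinality of the set of coherent subtoposes of $\mathsf{PSh}(P)$, i.e. of the $J$ such that $\mathsf{PSh}(P)$ and $\mathsf{Sh}(P,J)$ are coherent toposes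 and the sheafification functor $\mathsf{PSh}(P) \to \mathsf{Sh}(P,J)$ preserves coherent objects; - $\mathbf{ep}$ be the cardinality of the set of subtoposes of $\mathsf{PSh}(P)$ with enough points, i.e. of the $J$ such that $\mathsf{Sh}(P,J)$ has enough points; - $\mathbf{gt}$ be the cardinality of the set of all Grothendieck topologies on $P$. Here an object of a topos is compact if every epimorphic family with that codomain contains a finite epimorphic subfamily; it is coherent if it is compact and the pullback of any diagram of compact objects over it is compact; a topos is coherent if it contains a full subcategory of compact generators closed under finite limits. Then $$\mathbf{x} = \mathbf{cl} = \mathbf{coh} = 2^{\omega} \qquad\text{and}\qquad \mathbf{ep} = \mathbf{gt} = 2^{(2^{\omega})}.$$ -/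

import Mathlib

open CategoryTheory CategoryTheory.Limits
open scoped Cardinal

universe v u

/-! ### Compact and coherent objects, coherent toposes -/

section Topos

variable {E : Type u} [Category.{v} E]

/-- A family of morphisms with common codomain `X` is epimorphic if two morphisms out of `X`
that agree after composition with every member of the family are equal. -/
def IsEpimorphicFamily {ι : Type*} {X : E} {Y : ι → E} (f : ∀ i, Y i ⟶ X) : Prop :=
  ∀ ⦃Z : E⦄ (g h : X ⟶ Z), (∀ i, f i ≫ g = f i ≫ h) → g = h

/-- An object is compact if every (small) epimorphic family with this codomain
contains a finite epimorphic subfamily. -/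
def IsCompactObject (X : E) : Prop :=
  ∀ ⦃ι : Type v⦄ (Y : ι → E) (f : ∀ i, Y i ⟶ X), IsEpimorphicFamily f →
    ∃ s : Finset ι, IsEpimorphicFamily (fun i : s => f i)

/-- An object `X` is coherent if it is compact and if the pullback of every diagram
`A ⟶ X ⟵ B` with `A` and `B` compact is compact. -/
def IsCoherentObject (X : E) : Prop :=
  IsCompactObject X ∧
    ∀ ⦃Q A B : E⦄ (p : Q ⟶ A) (q : Q ⟶ B) (f : A ⟶ X) (g : B ⟶ X),
      IsCompactObject A → IsCompactObject B → IsPullback p q f g → IsCompactObject Q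

variable (E) in
/-- A topos is coherent if it contains a full subcategory of compact generators that is closed
under finite limits. -/
def IsCoherentTopos : Prop :=
  ∃ K : ObjectProperty E,
    (∀ X : E, K X → IsCompactObject X) ∧
    K.IsSeparating ∧
    ∀ (S : Type) [SmallCategory S] [FinCategory S], K.IsClosedUnderLimitsOfShape S

end Topos

/-! ### Subtoposes of a presheaf topos

The subtoposes of `PSh(C)`, for a small category `C`, are the full subcategories `Sh(C, J)` for
the Grothendieck topologies `J` on `C`, and distinct topologies give distinct subtoposes. -/

section Subtopos

variable {C : Type u} [SmallCategory C]

/-- The subtopos `Sh(C, J)` of `PSh(C)` is closed: for some subterminal presheaf `U`, it is the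
closed complement of the open subtopos associated with `U`, that is, the full subcategory on the
presheaves `F` such that the projection `F × U ⟶ U` is an isomorphism. -/
def IsClosedSubtopos (J : GrothendieckTopology C) : Prop :=
  ∃ U : Cᵒᵖ ⥤ Type u, IsSubterminal U ∧
    ∀ F : Cᵒᵖ ⥤ Type u, Presheaf.IsSheaf J F ↔ IsIso (prod.snd : F ⨯ U ⟶ U)

/-- `Sh(C, J)` is a coherent subtopos of the coherent topos `PSh(C)`: it is a coherent topos, and
the inverse image functor of the inclusion (sheafification) preserves coherent objects. -/
def IsCoherentSubtopos (J : GrothendieckTopology C) : Prop :=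
  IsCoherentTopos (Cᵒᵖ ⥤ Type u) ∧
  IsCoherentTopos (Sheaf J (Type u)) ∧
  ∀ F : Cᵒᵖ ⥤ Type u, IsCoherentObject F →
    IsCoherentObject ((presheafToSheaf J (Type u)).obj F)

end Subtopos

/-! ### The big cell and the supernatural numbers -/

/-- The set of positive integers, to be ordered by reverse divisibility. -/
@[ext]
structure BigCell where
  /-- The underlying positive integer. -/
  val : ℕ+

/-- `m ≤ n` if and only if `n` divides `m`. The associated category (one morphism `m ⟶ n` when
`m ≤ n`) is Mathlib's `Preorder.smallCategory`. -/
instance : PartialOrder BigCell where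
  le m n := n.val ∣ m.val
  le_refl m := dvd_refl m.val
  le_trans _ _ _ h₁ h₂ := dvd_trans h₂ h₁
  le_antisymm _ _ h₁ h₂ := BigCell.ext (PNat.dvd_antisymm h₂ h₁)

/-- A supernatural number `∏ q ^ e q` (product over all primes `q`) is given by its exponents
`e q ∈ {0, 1, 2, …, ∞}`; divisibility is the pointwise order on exponents. -/
abbrev Supernatural : Type := Nat.Primes → ℕ∞

/-! A filter on $P$ is closed under least common multiples and divisors, so it is determined by the
supremum of its exponents at each prime (`pfilterEquivSupernatural`); there are $\omega^\omega =
2^\omega$ such exponent functions. Closed subtoposes correspond to lower sets of $P$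
(`isClosedSubtopos_iff`). Countability of $P$ bounds their number by $2^\omega$, and sets of primes
give that many. Coherent subtoposes are exactly those whose topology is finitary
(`isCoherentSubtopos_iff`). A finitary topology is determined by its finitely generated covering
sieves, and only countably many sieves are finitely generated, so $2^\omega$ is an upper bound. It
is attained because closed topologies are finitary. The characterization rests on translating
epimorphic families into sets of elements that generate locally (`generates_iff_forall_hom_eq`).
Every set $Y$ of filters defines a topology with enough points, and distinct subsets of an antichain
define distinct topologies (`filterTopology_image_injective`). An antichain of $2^\omega$ filters
exists, which gives $2^{(2^\omega)}$ from below. A topology is a set of sieves and there are at most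
$2^\omega$ sieves, which gives the upper bound. -/

/-! ### Epimorphic families and compactness in terms of elements -/

section LocalGeneration

open Opposite

variable {C : Type u} [SmallCategory C]

/-- The sieve of arrows along which `x` becomes a restriction of an element of `D`. -/
def genSieve {X : Cᵒᵖ ⥤ Type u} (D : Set (Σ c : C, X.obj (op c))) {c : C} (x : X.obj (op c)) :
    Sieve c where
  arrows d g := ∃ p ∈ D, ∃ h : d ⟶ p.1, X.map h.op p.2 = X.map g.op x
  downward_closed := by
    rintro d e g ⟨p, hp, h, e₁⟩ k
    exact ⟨p, hp, k ≫ h, by simp [e₁]⟩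

/-- A set of elements of a presheaf generates it locally for `J`. -/
def Generates (J : GrothendieckTopology C) (X : Cᵒᵖ ⥤ Type u)
    (D : Set (Σ c : C, X.obj (op c))) : Prop :=
  ∀ ⦃c : C⦄ (x : X.obj (op c)), genSieve D x ∈ J c

lemma genSieve_map {X : Cᵒᵖ ⥤ Type u} (D : Set (Σ c : C, X.obj (op c))) {c d : C}
    (x : X.obj (op c)) (g : d ⟶ c) : genSieve D (X.map g.op x) = (genSieve D x).pullback g := by
  ext e h
  simp [genSieve]

lemma genSieve_of_mem {X : Cᵒᵖ ⥤ Type u} {D : Set (Σ c : C, X.obj (op c))}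
    {p : Σ c : C, X.obj (op c)} (hp : p ∈ D) : genSieve D p.2 = ⊤ := by
  rw [← Sieve.id_mem_iff_eq_top]
  exact ⟨p, hp, 𝟙 _, rfl⟩

lemma genSieve_mono {X : Cᵒᵖ ⥤ Type u} {D D' : Set (Σ c : C, X.obj (op c))} (h : D ⊆ D')
    {c : C} (x : X.obj (op c)) : genSieve D x ≤ genSieve D' x := by
  rintro d g ⟨p, hp, k, e⟩
  exact ⟨p, h hp, k, e⟩

lemma Generates.mono {J : GrothendieckTopology C} {X : Cᵒᵖ ⥤ Type u}
    {D D' : Set (Σ c : C, X.obj (op c))} (hD : Generates J X D) (h : D ⊆ D') :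
    Generates J X D' :=
  fun _ x => J.superset_covering (genSieve_mono h x) (hD x)

lemma Generates.trans {J : GrothendieckTopology C} {X : Cᵒᵖ ⥤ Type u}
    {D D' : Set (Σ c : C, X.obj (op c))} (hD : Generates J X D)
    (h : ∀ p ∈ D, genSieve D' p.2 ∈ J p.1) : Generates J X D' := by
  intro c x
  refine J.transitive (hD x) _ ?_
  rintro d g ⟨p, hp, k, e⟩
  rw [← genSieve_map, ← e, genSieve_map]
  exact J.pullback_stable _ (h p hp)

/-- The morphism to the presheaf of closed sieves that classifies the local closure of `D`. -/
def genClassifier (J : GrothendieckTopology C) {X : Cᵒᵖ ⥤ Type u}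
    (D : Set (Σ c : C, X.obj (op c))) : X ⟶ (Functor.closedSieves J).toFunctor where
  app c := ↾fun x => ⟨J.close (genSieve (c := c.unop) D x), J.close_isClosed _⟩
  naturality c d g := by
    ext x
    apply Subtype.ext
    change J.close (genSieve D (X.map g.unop.op x)) = (J.close (genSieve D x)).pullback g.unop
    rw [genSieve_map, J.pullback_close]

/-- Sheaves are separated, which gives one direction. For the other, the sheaf of closed sieves is a
sufficient test object: the classifiers of `D` and of all elements agree on `D`, so they are equal,
and then the closure of each `genSieve D x` is maximal. -/
lemma generates_iff_forall_hom_eq (J : GrothendieckTopology C) (X : Cᵒᵖ ⥤ Type u)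
    (D : Set (Σ c : C, X.obj (op c))) :
    Generates J X D ↔ ∀ ⦃Z : Cᵒᵖ ⥤ Type u⦄, Presheaf.IsSheaf J Z → ∀ g h : X ⟶ Z,
      (∀ p ∈ D, g.app _ p.2 = h.app _ p.2) → g = h := by
  constructor
  · intro hD Z hZ g h hgh
    ext c x
    refine (((isSheaf_iff_isSheaf_of_type _ _).1 hZ).isSeparated _ (hD x)).ext ?_
    rintro d k ⟨p, hp, l, e⟩
    change Z.map k.op (g.app c x) = Z.map k.op (h.app c x)
    have hg := NatTrans.naturality_apply g k.op x
    have hh := NatTrans.naturality_apply h k.op x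
    rw [← hg, ← hh, ← e, NatTrans.naturality_apply, NatTrans.naturality_apply, hgh p hp]
  · intro H c x
    have hg := H ((isSheaf_iff_isSheaf_of_type _ _).2 (classifier_isSheaf J))
      (genClassifier J D) (genClassifier J Set.univ) (by
        intro p hp
        apply Subtype.ext
        change J.close (genSieve D p.2) = J.close (genSieve Set.univ p.2)
        rw [genSieve_of_mem hp, genSieve_of_mem (Set.mem_univ p)])
    rw [← J.close_eq_top_iff_mem]
    have h1 : J.close (genSieve D x) = J.close (genSieve Set.univ x) :=
      congr_arg Subtype.val (ConcreteCategory.congr_hom (NatTrans.congr_app hg (op c)) x :)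
    rw [h1, genSieve_of_mem (p := ⟨c, x⟩) (Set.mem_univ _)]
    exact top_unique (J.le_close ⊤)

/-- The set of elements in the images of a family of morphisms. -/
def imageElements {ι : Type*} {X : Cᵒᵖ ⥤ Type u} {Y : ι → Cᵒᵖ ⥤ Type u} (f : ∀ i, Y i ⟶ X) :
    Set (Σ c : C, X.obj (op c)) :=
  {p | ∃ i y, (f i).app _ y = p.2}

lemma forall_imageElements_iff {ι : Type*} {X Z : Cᵒᵖ ⥤ Type u} {Y : ι → Cᵒᵖ ⥤ Type u}
    (f : ∀ i, Y i ⟶ X) (g h : X ⟶ Z) :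
    (∀ p ∈ imageElements f, g.app _ p.2 = h.app _ p.2) ↔ ∀ i, f i ≫ g = f i ≫ h := by
  constructor
  · intro H i
    ext c y
    exact H ⟨c.unop, (f i).app _ y⟩ ⟨i, y, rfl⟩
  · rintro H ⟨c, x⟩ ⟨i, y, hy⟩
    dsimp only at hy ⊢
    rw [← hy]
    exact ConcreteCategory.congr_hom (NatTrans.congr_app (H i) _) y

lemma isSheaf_bot_type (Z : Cᵒᵖ ⥤ Type u) : Presheaf.IsSheaf ⊥ Z :=
  (isSheaf_iff_isSheaf_of_type _ _).2 Presieve.isSheaf_bot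

lemma presheaf_isEpimorphicFamily_iff {ι : Type*} {X : Cᵒᵖ ⥤ Type u} {Y : ι → Cᵒᵖ ⥤ Type u}
    (f : ∀ i, Y i ⟶ X) : IsEpimorphicFamily f ↔ Generates ⊥ X (imageElements f) := by
  rw [generates_iff_forall_hom_eq]
  simp only [forall_imageElements_iff]
  exact ⟨fun H Z _ => @H Z, fun H Z => H (isSheaf_bot_type Z)⟩

lemma sheaf_isEpimorphicFamily_iff {J : GrothendieckTopology C} {ι : Type*} {X : Sheaf J (Type u)}
    {Y : ι → Sheaf J (Type u)} (f : ∀ i, Y i ⟶ X) :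
    IsEpimorphicFamily f ↔ Generates J X.obj (imageElements fun i => (f i).hom) := by
  rw [generates_iff_forall_hom_eq]
  simp only [forall_imageElements_iff]
  constructor
  · intro H Z hZ g h e
    have := @H ⟨Z, hZ⟩ ⟨g⟩ ⟨h⟩ (fun i => Sheaf.hom_ext (e i))
    exact congr_arg (·.hom) this
  · intro H Z g h e
    exact Sheaf.hom_ext (H Z.property g.hom h.hom fun i => congr_arg (·.hom) (e i))

/-- Every locally generating set of elements contains a finite one. -/
def LocallyCompact (J : GrothendieckTopology C) (X : Cᵒᵖ ⥤ Type u) : Prop :=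
  ∀ D : Set (Σ c : C, X.obj (op c)), Generates J X D →
    ∃ s : Set (Σ c : C, X.obj (op c)), s ⊆ D ∧ s.Finite ∧ Generates J X s

lemma exists_finite_of_generates_imageElements {J : GrothendieckTopology C} {X : Cᵒᵖ ⥤ Type u}
    (hX : LocallyCompact J X) {ι : Type*} {Y : ι → Cᵒᵖ ⥤ Type u} (f : ∀ i, Y i ⟶ X)
    (hf : Generates J X (imageElements f)) :
    ∃ s : Finset ι, Generates J X (imageElements fun i : s => f i) := by
  classical
  obtain ⟨s, hs, hfin, hgen⟩ := hX _ hf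
  choose i hi using fun p : s => hs p.2
  have : Finite s := hfin
  refine ⟨(Set.finite_range i).toFinset, hgen.mono fun p hp => ?_⟩
  obtain ⟨y, hy⟩ := hi ⟨p, hp⟩
  exact ⟨⟨i ⟨p, hp⟩, by simp⟩, y, hy⟩

lemma yonedaEquiv_symm_comp_eq_iff {X Z : Cᵒᵖ ⥤ Type u} {c : C} (x : X.obj (op c))
    (g h : X ⟶ Z) :
    yonedaEquiv.symm x ≫ g = yonedaEquiv.symm x ≫ h ↔ g.app _ x = h.app _ x := by
  rw [yonedaEquiv_symm_naturality_right, yonedaEquiv_symm_naturality_right,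
    yonedaEquiv.symm.injective.eq_iff]

lemma presheaf_isEpimorphicFamily_yoneda_iff {ι : Type*} {X : Cᵒᵖ ⥤ Type u}
    (x : ι → Σ c : C, X.obj (op c)) :
    IsEpimorphicFamily (fun i => yonedaEquiv.symm (x i).2) ↔ Generates ⊥ X (Set.range x) := by
  rw [generates_iff_forall_hom_eq]
  simp only [Set.forall_mem_range, ← yonedaEquiv_symm_comp_eq_iff]
  exact ⟨fun H Z _ => @H Z, fun H Z => H (isSheaf_bot_type Z)⟩

lemma isCompactObject_presheaf_iff (X : Cᵒᵖ ⥤ Type u) :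
    IsCompactObject X ↔ LocallyCompact ⊥ X := by
  constructor
  · intro hX D hD
    obtain ⟨s, hs⟩ := hX (ι := D) _ (fun p => yonedaEquiv.symm p.1.2)
      ((presheaf_isEpimorphicFamily_yoneda_iff _).2 (by simpa using hD))
    exact ⟨_, by rintro _ ⟨p, rfl⟩; exact p.1.2, Set.finite_range _,
      (presheaf_isEpimorphicFamily_yoneda_iff fun p : s => p.1.1).1 hs⟩
  · intro hX ι Y f hf
    obtain ⟨s, hs⟩ := exists_finite_of_generates_imageElements hX f
      ((presheaf_isEpimorphicFamily_iff f).1 hf)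
    exact ⟨s, (presheaf_isEpimorphicFamily_iff _).2 hs⟩

variable {J : GrothendieckTopology C}

/-- The morphism from a sheafified representable that corresponds to a section. -/
noncomputable def sectionHom (X : Sheaf J (Type u)) {c : C} (x : X.obj.obj (op c)) :
    (presheafToSheaf J (Type u)).obj (yoneda.obj c) ⟶ X :=
  ⟨sheafifyLift J (yonedaEquiv.symm x) X.property⟩

lemma sectionHom_comp_eq_iff {X Z : Sheaf J (Type u)} {c : C} (x : X.obj.obj (op c))
    (g h : X ⟶ Z) :
    sectionHom X x ≫ g = sectionHom X x ≫ h ↔ g.hom.app _ x = h.hom.app _ x := by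
  rw [← yonedaEquiv_symm_comp_eq_iff, Sheaf.hom_ext_iff]
  change sheafifyLift J _ X.property ≫ g.hom = sheafifyLift J _ X.property ≫ h.hom ↔ _
  rw [← sheafifyLift_comp J _ X.property _ Z.property,
    ← sheafifyLift_comp J _ X.property _ Z.property]
  constructor
  · intro e
    rw [← toSheafify_sheafifyLift J (yonedaEquiv.symm x ≫ g.hom) Z.property, e,
      toSheafify_sheafifyLift]
  · intro e
    rw [e]

lemma sheaf_isEpimorphicFamily_sectionHom_iff {ι : Type*} {X : Sheaf J (Type u)}
    (x : ι → Σ c : C, X.obj.obj (op c)) :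
    IsEpimorphicFamily (fun i => sectionHom X (x i).2) ↔ Generates J X.obj (Set.range x) := by
  rw [generates_iff_forall_hom_eq]
  simp only [Set.forall_mem_range]
  constructor
  · intro H Z hZ g h e
    have := @H ⟨Z, hZ⟩ ⟨g⟩ ⟨h⟩ (fun i => (sectionHom_comp_eq_iff _ _ _).2 (e i))
    exact congr_arg (·.hom) this
  · intro H Z g h e
    exact Sheaf.hom_ext (H Z.property _ _ fun i => (sectionHom_comp_eq_iff _ _ _).1 (e i))

lemma isCompactObject_sheaf_iff (X : Sheaf J (Type u)) :
    IsCompactObject X ↔ LocallyCompact J X.obj := by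
  constructor
  · intro hX D hD
    obtain ⟨s, hs⟩ := hX (ι := D) _ (fun p => sectionHom X p.1.2)
      ((sheaf_isEpimorphicFamily_sectionHom_iff _).2 (by simpa using hD))
    exact ⟨_, by rintro _ ⟨p, rfl⟩; exact p.1.2, Set.finite_range _,
      (sheaf_isEpimorphicFamily_sectionHom_iff fun p : s => p.1.1).1 hs⟩
  · intro hX ι Y f hf
    obtain ⟨s, hs⟩ := exists_finite_of_generates_imageElements hX _
      ((sheaf_isEpimorphicFamily_iff f).1 hf)
    exact ⟨s, (sheaf_isEpimorphicFamily_iff _).2 hs⟩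

end LocalGeneration

/-! ### Finitary topologies -/

section Finitary

open Opposite

variable {C : Type u} [SmallCategory C]

/-- A topology is finitary if every covering sieve contains a finitely generated one. -/
def GrothendieckTopology.IsFinitary (J : GrothendieckTopology C) : Prop :=
  ∀ ⦃c : C⦄ (S : Sieve c), S ∈ J c → ∃ s : Set (Σ d : C, d ⟶ c), s.Finite ∧
    (∀ p ∈ s, S p.2) ∧ Sieve.generate (fun d g => ⟨d, g⟩ ∈ s) ∈ J c

lemma isFinitary_bot : GrothendieckTopology.IsFinitary (⊥ : GrothendieckTopology C) := by
  intro c S hS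
  rw [GrothendieckTopology.bot_covering] at hS
  subst hS
  refine ⟨{⟨c, 𝟙 c⟩}, Set.finite_singleton _, by simp, ?_⟩
  rw [GrothendieckTopology.bot_covering, ← Sieve.id_mem_iff_eq_top]
  exact ⟨c, 𝟙 c, 𝟙 c, rfl, by simp⟩

/-- Each of the finitely many generators is covered by a sieve of restrictions from `D`; a finitely
generated subcover involves only finitely many members of `D`. -/
lemma GrothendieckTopology.IsFinitary.locallyCompact {J : GrothendieckTopology C}
    (hJ : GrothendieckTopology.IsFinitary J) {X : Cᵒᵖ ⥤ Type u}
    {s : Set (Σ c : C, X.obj (op c))} (hs : s.Finite) (hX : Generates J X s) :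
    LocallyCompact J X := by
  intro D hD
  choose t ht hts htc using fun p : s => hJ _ (hD p.1.2)
  choose q hq k hk using hts
  have : Finite s := hs
  have (p : s) : Finite (t p) := ht p
  refine ⟨Set.range fun x : Σ p : s, t p => q x.1 x.2.1 x.2.2, ?_, Set.finite_range _, ?_⟩
  · rintro _ ⟨x, rfl⟩
    exact hq _ _ _
  · refine hX.trans fun p hp => J.superset_covering ?_ (htc ⟨p, hp⟩)
    rw [Sieve.generate_le_iff]
    intro d g hg
    exact ⟨_, ⟨⟨⟨p, hp⟩, ⟨_, hg⟩⟩, rfl⟩, k ⟨p, hp⟩ _ hg, hk ⟨p, hp⟩ _ hg⟩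

/-- The action of a morphism of presheaves on elements. -/
def mapElement {X Y : Cᵒᵖ ⥤ Type u} (f : X ⟶ Y) (p : Σ c : C, X.obj (op c)) :
    Σ c : C, Y.obj (op c) :=
  ⟨p.1, f.app _ p.2⟩

lemma genSieve_le_genSieve_mapElement {X Y : Cᵒᵖ ⥤ Type u} (f : X ⟶ Y)
    (D : Set (Σ c : C, X.obj (op c))) {c : C} (x : X.obj (op c)) :
    genSieve D x ≤ genSieve (mapElement f '' D) (f.app _ x) := by
  rintro d g ⟨p, hp, k, e⟩
  refine ⟨_, ⟨p, hp, rfl⟩, k, ?_⟩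
  change Y.map k.op (f.app _ p.2) = _
  rw [← NatTrans.naturality_apply, ← NatTrans.naturality_apply, e]

lemma Generates.map {J : GrothendieckTopology C} {X Y : Cᵒᵖ ⥤ Type u} (f : X ⟶ Y)
    [Presheaf.IsLocallySurjective J f] {D : Set (Σ c : C, X.obj (op c))}
    (hD : Generates J X D) : Generates J Y (mapElement f '' D) := by
  intro c y
  refine J.transitive (Presheaf.imageSieve_mem J f y) _ ?_
  rintro d g ⟨x, hx⟩
  rw [← genSieve_map, ← hx]
  exact J.superset_covering (genSieve_le_genSieve_mapElement f D x) (hD x)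

lemma generates_yoneda (J : GrothendieckTopology C) (c : C) :
    Generates J (yoneda.obj c) {⟨c, 𝟙 c⟩} := by
  intro d g
  refine J.superset_covering (fun e k _ => ?_) (J.top_mem d)
  exact ⟨_, rfl, k ≫ g, by simp⟩

lemma generates_iff_generates_bot (X : Cᵒᵖ ⥤ Type u) (D : Set (Σ c : C, X.obj (op c))) :
    Generates ⊥ X D ↔ ∀ ⦃c : C⦄ (x : X.obj (op c)), ∃ p ∈ D, ∃ h : c ⟶ p.1, X.map h.op p.2 = x := by
  simp only [Generates, GrothendieckTopology.bot_covering, ← Sieve.id_mem_iff_eq_top]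
  simp [genSieve]

lemma Generates.of_bot {J : GrothendieckTopology C} {X : Cᵒᵖ ⥤ Type u}
    {D : Set (Σ c : C, X.obj (op c))} (hD : Generates ⊥ X D) : Generates J X D := by
  intro c x
  have := hD x
  rw [GrothendieckTopology.bot_covering] at this
  rw [this]
  exact J.top_mem c

/-- A covering sieve on `c` is a locally generating set of elements of the sheafified representable,
and a finite generating subset yields the finite subcover. -/
lemma isFinitary_of_isCompactObject {J : GrothendieckTopology C}
    (H : ∀ c : C, IsCompactObject ((presheafToSheaf J (Type u)).obj (yoneda.obj c))) :
    GrothendieckTopology.IsFinitary J := by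
  intro c S hS
  let η := toSheafify J (yoneda.obj c)
  let x : (sheafify J (yoneda.obj c)).obj (op c) := η.app (op c) (𝟙 c)
  have hη {d : C} (g : d ⟶ c) : η.app (op d) g = (sheafify J (yoneda.obj c)).map g.op x := by
    have := NatTrans.naturality_apply η g.op (𝟙 c)
    rw [← this]
    simp
  let D : Set (Σ d : C, (sheafify J (yoneda.obj c)).obj (op d)) :=
    (fun p : Σ d : C, d ⟶ c => ⟨p.1, η.app (op p.1) p.2⟩) '' {p | S p.2}
  have hD : Generates J (sheafify J (yoneda.obj c)) D := by
    refine ((generates_yoneda J c).map η).trans ?_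
    rintro _ ⟨_, rfl, rfl⟩
    refine J.superset_covering (fun d g hg => ?_) hS
    exact ⟨_, ⟨⟨d, g⟩, hg, rfl⟩, 𝟙 d, by simpa using! hη g⟩
  obtain ⟨t, ht, htf, hgen⟩ := Set.exists_subset_image_finite_and.1
    ((isCompactObject_sheaf_iff _).1 (H c) D hD)
  refine ⟨t, htf, ht, J.transitive (hgen x) _ ?_⟩
  rintro d k ⟨_, ⟨⟨e, g⟩, hg, rfl⟩, h, eq⟩
  have eq' : η.app (op d) (h ≫ g) = η.app (op d) k := by
    rw [hη k]
    refine Eq.trans ?_ eq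
    exact NatTrans.naturality_apply η h.op g
  -- Arrows identified by sheafification agree only after restriction to a covering sieve.
  refine J.superset_covering ?_ (Presheaf.equalizerSieve_mem J η (X := op d)
    (show ToType ((yoneda.obj c).obj (op d)) from h ≫ g)
    (show ToType ((yoneda.obj c).obj (op d)) from k) eq')
  intro d' l hl
  exact ⟨e, l ≫ h, g, hg, by simpa using! hl⟩

end Finitary

/-! ### Coherence over a meet-semilattice -/

section Semilattice

open Opposite

variable {P : Type u} [SemilatticeInf P]

/-- The sieve on `d` of all elements below `c`. -/
def lowerSieve (d c : P) : Sieve d where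
  arrows e _ := e ≤ c
  downward_closed h g := g.le.trans h

lemma lowerSieve_mono (d : P) {c c' : P} (h : c ≤ c') : lowerSieve d c ≤ lowerSieve d c' :=
  fun _ _ h' => le_trans h' h

/-- A presheaf on a poset is locally representable if it has at most one section over each
object, and one exactly over the objects that are locally below some fixed `c`. -/
def IsLocallyRepresentable (J : GrothendieckTopology P) : ObjectProperty (Pᵒᵖ ⥤ Type u) :=
  fun X => (∀ d : P, Subsingleton (X.obj (op d))) ∧
    ∃ c : P, ∀ d : P, Nonempty (X.obj (op d)) ↔ lowerSieve d c ∈ J d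

lemma IsLocallyRepresentable.locallyCompact {J : GrothendieckTopology P}
    (hJ : GrothendieckTopology.IsFinitary J) {X : Pᵒᵖ ⥤ Type u}
    (hX : IsLocallyRepresentable J X) : LocallyCompact J X := by
  obtain ⟨hs, c, hc⟩ := hX
  obtain ⟨x⟩ : Nonempty (X.obj (op c)) :=
    (hc c).2 (J.superset_covering (fun _ f _ => f.le) (J.top_mem c))
  refine hJ.locallyCompact (Set.finite_singleton ⟨c, x⟩) fun d y => ?_
  refine J.superset_covering (fun e g (hg : e ≤ c) => ?_) ((hc d).1 ⟨y⟩)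
  exact ⟨_, rfl, homOfLE hg, Subsingleton.elim _ _⟩

lemma isLocallyRepresentable_yoneda (c : P) :
    IsLocallyRepresentable ⊥ (yoneda.obj c) := by
  refine ⟨fun d => inferInstanceAs (Subsingleton (d ⟶ c)), c, fun d => ?_⟩
  rw [GrothendieckTopology.bot_covering, ← Sieve.id_mem_iff_eq_top]
  exact ⟨fun ⟨f⟩ => Quiver.Hom.le f, fun h => ⟨homOfLE h⟩⟩

lemma isLocallyRepresentable_sheafify_yoneda (J : GrothendieckTopology P) (c : P) :
    IsLocallyRepresentable J (sheafify J (yoneda.obj c)) := by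
  have hZ := (presheafToSheaf J (Type u)).obj (yoneda.obj c) |>.property
  have hZ' := (isSheaf_iff_isSheaf_of_type _ _).1 hZ
  let η := toSheafify J (yoneda.obj c)
  have hsub (d : P) : Subsingleton ((sheafify J (yoneda.obj c)).obj (op d)) := by
    refine ⟨fun x y => ?_⟩
    refine (hZ'.isSeparated _ (J.intersection_covering
      (Presheaf.imageSieve_mem J η x) (Presheaf.imageSieve_mem J η y))).ext ?_
    rintro e g ⟨⟨x', hx⟩, ⟨y', hy⟩⟩
    have : Subsingleton (e ⟶ c) := inferInstance
    refine hx.symm.trans (Eq.trans ?_ hy)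
    exact congr_arg _ (this.elim x' y')
  refine ⟨hsub, c, fun d => ⟨?_, fun h => ?_⟩⟩
  · rintro ⟨x⟩
    refine J.superset_covering ?_ (Presheaf.imageSieve_mem J η x)
    rintro e g ⟨y, -⟩
    exact Quiver.Hom.le y
  · exact ⟨(hZ' _ h).amalgamate (fun e g hg => η.app (op e) (homOfLE hg))
      fun _ _ _ _ _ _ _ _ _ _ => Subsingleton.elim _ _⟩

lemma presheaf_exists_of_isPullback {Q A B F : Pᵒᵖ ⥤ Type u} {p : Q ⟶ A} {q : Q ⟶ B} {f : A ⟶ F}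
    {g : B ⟶ F} (h : IsPullback p q f g) {c : Pᵒᵖ} (a : A.obj c) (b : B.obj c)
    (hab : f.app c a = g.app c b) : ∃ z, p.app c z = a ∧ q.app c z = b :=
  Types.exists_of_isPullback (h.map ((evaluation Pᵒᵖ (Type u)).obj c)) a b hab

lemma presheaf_ext_of_isPullback {Q A B F : Pᵒᵖ ⥤ Type u} {p : Q ⟶ A} {q : Q ⟶ B} {f : A ⟶ F}
    {g : B ⟶ F} (h : IsPullback p q f g) {c : Pᵒᵖ} {z z' : Q.obj c}
    (h₁ : p.app c z = p.app c z') (h₂ : q.app c z = q.app c z') : z = z' :=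
  Types.ext_of_isPullback (h.map ((evaluation Pᵒᵖ (Type u)).obj c)) h₁ h₂

lemma IsCompactObject.exists_finite_generates {X : Pᵒᵖ ⥤ Type u} (hX : IsCompactObject X) :
    ∃ s : Set (Σ c : P, X.obj (op c)), s.Finite ∧ Generates ⊥ X s := by
  obtain ⟨s, -, hs, hgen⟩ := (isCompactObject_presheaf_iff _).1 hX Set.univ
    ((generates_iff_generates_bot _ _).2 fun c z => ⟨⟨c, z⟩, Set.mem_univ _, 𝟙 c, by simp⟩)
  exact ⟨s, hs, hgen⟩

/-- The pullback of the two representables along `x` and `y` is compact, and it is inhabited exactly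
over the common lower bounds where the restrictions agree. -/
lemma IsCoherentObject.exists_finite_forall_le {F : Pᵒᵖ ⥤ Type u} (hF : IsCoherentObject F) {c d : P}
    (x : F.obj (op c)) (y : F.obj (op d)) :
    ∃ s : Set P, s.Finite ∧
      (∀ e ∈ s, ∃ (f : e ⟶ c) (g : e ⟶ d), F.map f.op x = F.map g.op y) ∧
      ∀ e (f : e ⟶ c) (g : e ⟶ d), F.map f.op x = F.map g.op y → ∃ e' ∈ s, e ≤ e' := by
  have hy (c : P) : IsCompactObject (yoneda.obj c) := (isCompactObject_presheaf_iff _).2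
    ((isLocallyRepresentable_yoneda c).locallyCompact isFinitary_bot)
  have hpb := IsPullback.of_hasPullback (yonedaEquiv.symm x) (yonedaEquiv.symm y)
  have h := hF.2 _ _ _ _ (hy c) (hy d) hpb
  obtain ⟨s, hs, hgen⟩ := h.exists_finite_generates
  rw [generates_iff_generates_bot] at hgen
  refine ⟨Sigma.fst '' s, hs.image _, ?_, fun e f g hfg => ?_⟩
  · rintro _ ⟨⟨e, z⟩, -, rfl⟩
    exact ⟨(pullback.fst (yonedaEquiv.symm x) (yonedaEquiv.symm y)).app (op e) z,
      (pullback.snd (yonedaEquiv.symm x) (yonedaEquiv.symm y)).app (op e) z,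
      ConcreteCategory.congr_hom (NatTrans.congr_app hpb.w (op e)) z⟩
  · obtain ⟨z, -⟩ := presheaf_exists_of_isPullback hpb (c := op e) f g hfg
    obtain ⟨p, hp, k, -⟩ := hgen z
    exact ⟨p.1, ⟨p, hp, rfl⟩, k.le⟩

lemma exists_finite_generates_lift {J : GrothendieckTopology P} {F A G : Pᵒᵖ ⥤ Type u}
    (hA : LocallyCompact J A) (η : F ⟶ G) [Presheaf.IsLocallySurjective J η] (f : A ⟶ G) :
    ∃ s : Set (Σ c : P, A.obj (op c)), s.Finite ∧ Generates J A s ∧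
      ∀ p ∈ s, ∃ x, η.app (op p.1) x = f.app _ p.2 := by
  obtain ⟨s, h, hs, hgen⟩ := hA {p | ∃ x, η.app (op p.1) x = f.app _ p.2} (by
    intro c a
    refine J.superset_covering ?_ (Presheaf.imageSieve_mem J η (f.app _ a))
    rintro d g ⟨x, hx⟩
    refine ⟨⟨d, A.map g.op a⟩, ⟨x, hx.trans ?_⟩, 𝟙 d, by simp⟩
    exact (NatTrans.naturality_apply f g.op a).symm)
  exact ⟨s, hs, hgen, h⟩

/-- Locally, both components of an element of `Q` are restrictions of generators `a` and `b`. Where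
these agree, the place is locally below some member of the finite set `E`, so the elements of `Q`
over those members generate. -/
lemma locallyCompact_of_isPullback {J : GrothendieckTopology P}
    (hJ : GrothendieckTopology.IsFinitary J) {Q A B G : Pᵒᵖ ⥤ Type u} {p : Q ⟶ A} {q : Q ⟶ B}
    {f : A ⟶ G} {g : B ⟶ G} (hpb : IsPullback p q f g)
    {s : Set (Σ c : P, A.obj (op c))} (hs : s.Finite) (hA : Generates J A s)
    {t : Set (Σ c : P, B.obj (op c))} (ht : t.Finite) (hB : Generates J B t)
    (H : ∀ a ∈ s, ∀ b ∈ t, ∃ E : Set P, E.Finite ∧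
      (∀ e ∈ E, ∃ (k : e ⟶ a.1) (l : e ⟶ b.1),
        G.map k.op (f.app _ a.2) = G.map l.op (g.app _ b.2)) ∧
      ∀ e (k : e ⟶ a.1) (l : e ⟶ b.1), G.map k.op (f.app _ a.2) = G.map l.op (g.app _ b.2) →
        ∃ S ∈ J e, ∀ e' (m : e' ⟶ e), S m → ∃ e'' ∈ E, e' ≤ e'') :
    LocallyCompact J Q := by
  choose E hE hEz hEc using fun (a : s) (b : t) => H a.1 a.2 b.1 b.2
  choose k l hkl using hEz
  have hz (a : s) (b : t) (e : P) (he : e ∈ E a b) : ∃ z : Q.obj (op e),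
      p.app _ z = A.map (k a b e he).op a.1.2 ∧ q.app _ z = B.map (l a b e he).op b.1.2 := by
    refine presheaf_exists_of_isPullback hpb _ _ ?_
    rw [NatTrans.naturality_apply, NatTrans.naturality_apply]
    exact hkl a b e he
  choose z hzp hzq using hz
  have : Finite s := hs
  have : Finite t := ht
  have (a : s) (b : t) : Finite (E a b) := hE a b
  refine hJ.locallyCompact (s := Set.range fun i : Σ (a : s) (b : t), E a b =>
    ⟨i.2.2.1, z i.1 i.2.1 i.2.2.1 i.2.2.2⟩) (Set.finite_range _) fun d w => ?_
  refine J.transitive (J.intersection_covering (hA (p.app _ w)) (hB (q.app _ w))) _ ?_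
  rintro e m ⟨⟨a, ha, i, hi⟩, ⟨b, hb, j, hj⟩⟩
  obtain ⟨S, hS, hSE⟩ := hEc ⟨a, ha⟩ ⟨b, hb⟩ e i j (by
    rw [← NatTrans.naturality_apply, ← NatTrans.naturality_apply, hi, hj,
      NatTrans.naturality_apply, NatTrans.naturality_apply]
    exact congr_arg _ (ConcreteCategory.congr_hom (NatTrans.congr_app hpb.w (op d)) w))
  refine J.superset_covering (fun e' n hn => ?_) hS
  obtain ⟨e'', he'', hle⟩ := hSE e' n hn
  refine ⟨_, ⟨⟨⟨a, ha⟩, ⟨b, hb⟩, ⟨e'', he''⟩⟩, rfl⟩, homOfLE hle, ?_⟩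
  have hk : homOfLE hle ≫ k ⟨a, ha⟩ ⟨b, hb⟩ e'' he'' = n ≫ i := Subsingleton.elim _ _
  have hl : homOfLE hle ≫ l ⟨a, ha⟩ ⟨b, hb⟩ e'' he'' = n ≫ j := Subsingleton.elim _ _
  refine presheaf_ext_of_isPullback hpb ?_ ?_
  · dsimp only
    rw [NatTrans.naturality_apply, NatTrans.naturality_apply, hzp, ← comp_apply, ← A.map_comp,
      ← op_comp, hk, op_comp, A.map_comp, comp_apply, hi]
    simp
  · dsimp only
    rw [NatTrans.naturality_apply, NatTrans.naturality_apply, hzq, ← comp_apply, ← B.map_comp,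
      ← op_comp, hl, op_comp, B.map_comp, comp_apply, hj]
    simp

/-- Any two restrictions to a common lower bound agree here, so the meet of the two vertices alone
serves as the finite set `E`. -/
lemma isCoherentObject_yoneda (c : P) : IsCoherentObject (yoneda.obj c) := by
  refine ⟨(isCompactObject_presheaf_iff _).2
    ((isLocallyRepresentable_yoneda c).locallyCompact isFinitary_bot), ?_⟩
  intro Q A B p q f g hA hB hpb
  obtain ⟨s, hs, hsA⟩ := hA.exists_finite_generates
  obtain ⟨t, ht, htB⟩ := hB.exists_finite_generates
  refine (isCompactObject_presheaf_iff _).2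
    (locallyCompact_of_isPullback isFinitary_bot hpb hs hsA ht htB fun a _ b _ =>
      ⟨{a.1 ⊓ b.1}, Set.finite_singleton _, ?_, fun e k l _ => ⟨⊤, GrothendieckTopology.top_mem _ _,
        fun e' m _ => ⟨_, rfl, le_inf (m ≫ k).le (m ≫ l).le⟩⟩⟩)
  rintro _ rfl
  have : Subsingleton ((yoneda.obj c).obj (op (a.1 ⊓ b.1))) :=
    (isLocallyRepresentable_yoneda c).1 _
  exact ⟨homOfLE inf_le_left, homOfLE inf_le_right, Subsingleton.elim _ _⟩

/-- Finitely many local generators can be chosen whose images lift to `F`. Coherence of `F` then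
supplies the finite set of bounds, since equality after sheafification is local equality in `F`. -/
theorem isCoherentObject_presheafToSheaf {J : GrothendieckTopology P}
    (hJ : GrothendieckTopology.IsFinitary J) {F : Pᵒᵖ ⥤ Type u} (hF : IsCoherentObject F) :
    IsCoherentObject ((presheafToSheaf J (Type u)).obj F) := by
  let η := toSheafify J F
  refine ⟨?_, ?_⟩
  · rw [isCompactObject_sheaf_iff]
    obtain ⟨s, hs, hgen⟩ := hF.1.exists_finite_generates
    exact hJ.locallyCompact (hs.image _) (hgen.of_bot.map η)
  · intro Q A B p q f g hA hB hpb
    rw [isCompactObject_sheaf_iff] at hA hB ⊢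
    obtain ⟨s, hs, hsA, hsx⟩ := exists_finite_generates_lift hA η f.hom
    obtain ⟨t, ht, htB, hty⟩ := exists_finite_generates_lift hB η g.hom
    refine locallyCompact_of_isPullback hJ (hpb.map (sheafToPresheaf J (Type u))) hs hsA ht htB
      fun a ha b hb => ?_
    obtain ⟨x, hx⟩ := hsx a ha
    obtain ⟨y, hy⟩ := hty b hb
    obtain ⟨E, hE, hEz, hEc⟩ := hF.exists_finite_forall_le x y
    have hη {e : P} (k : e ⟶ a.1) (l : e ⟶ b.1) :
        (sheafify J F).map k.op (f.hom.app _ a.2) = (sheafify J F).map l.op (g.hom.app _ b.2) ↔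
          η.app (op e) (F.map k.op x) = η.app (op e) (F.map l.op y) := by
      rw [← hx, ← hy, NatTrans.naturality_apply, NatTrans.naturality_apply]
    refine ⟨E, hE, fun e he => ?_, fun e k l h => ?_⟩
    · obtain ⟨k, l, h⟩ := hEz e he
      exact ⟨k, l, (hη k l).2 (congr_arg _ h)⟩
    · refine ⟨_, Presheaf.equalizerSieve_mem J η _ _ ((hη k l).1 h), fun e' n hn => ?_⟩
      exact hEc e' (n ≫ k) (n ≫ l) (by simpa using! hn)

variable [OrderTop P]

lemma lowerSieve_inf_mem_iff (J : GrothendieckTopology P) {ι : Type*} (s : Finset ι) (c : ι → P)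
    (d : P) : lowerSieve d (s.inf c) ∈ J d ↔ ∀ i ∈ s, lowerSieve d (c i) ∈ J d := by
  classical
  induction s using Finset.induction_on with
  | empty =>
    simp only [Finset.inf_empty, Finset.notMem_empty, false_imp_iff, implies_true, iff_true]
    exact J.superset_covering (fun _ _ _ => le_top) (J.top_mem d)
  | insert a s ha ih =>
    rw [Finset.inf_insert, Finset.forall_mem_insert, ← ih]
    constructor
    · exact fun h => ⟨J.superset_covering (lowerSieve_mono d inf_le_left) h,
        J.superset_covering (lowerSieve_mono d inf_le_right) h⟩
    · exact fun h => J.superset_covering (show lowerSieve d (c a) ⊓ lowerSieve d (s.inf c) ≤ _ from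
        fun _ _ h => le_inf h.1 h.2) (J.intersection_covering h.1 h.2)

instance isLocallyRepresentable_isClosedUnderLimitsOfShape (J : GrothendieckTopology P)
    (S : Type) [SmallCategory S] [FinCategory S] :
    (IsLocallyRepresentable J).IsClosedUnderLimitsOfShape S where
  limitsOfShape_le := by
    rintro X ⟨p⟩
    have hl (d : P) := isLimitOfPreserves ((evaluation Pᵒᵖ (Type u)).obj (op d)) p.isLimit
    have hs (d : P) (j : S) : Subsingleton ((p.diag.obj j).obj (op d)) := (p.prop_diag_obj j).1 d
    refine ⟨fun d => ⟨fun x y => ?_⟩, ?_⟩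
    · refine (Types.isLimitEquivSections (hl d)).injective (Subtype.ext (funext fun j => ?_))
      exact (hs d j).elim _ _
    · choose c hc using fun j => (p.prop_diag_obj j).2
      refine ⟨Finset.univ.inf c, fun d => ?_⟩
      rw [lowerSieve_inf_mem_iff]
      simp only [Finset.mem_univ, true_imp_iff, ← hc]
      constructor
      · rintro ⟨x⟩ j
        exact ⟨(p.π.app j).app _ x⟩
      · intro h
        exact ⟨(Types.isLimitEquivSections (hl d)).symm
          ⟨fun j => (h j).some, fun _ => (hs d _).elim _ _⟩⟩

theorem isCoherentTopos_presheaf : IsCoherentTopos (Pᵒᵖ ⥤ Type u) := by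
  refine ⟨IsLocallyRepresentable ⊥, fun X hX => ?_, ?_, fun S _ _ => inferInstance⟩
  · exact (isCompactObject_presheaf_iff X).2 (hX.locallyCompact isFinitary_bot)
  · intro X Y f g h
    ext c x
    exact (yonedaEquiv_symm_comp_eq_iff x f g).1 (h _ (isLocallyRepresentable_yoneda c.unop) _)

theorem isCoherentTopos_sheaf {J : GrothendieckTopology P}
    (hJ : GrothendieckTopology.IsFinitary J) : IsCoherentTopos (Sheaf J (Type u)) := by
  refine ⟨(IsLocallyRepresentable J).inverseImage (sheafToPresheaf J (Type u)),
    fun X hX => ?_, ?_, fun S _ _ => inferInstance⟩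
  · exact (isCompactObject_sheaf_iff X).2 (IsLocallyRepresentable.locallyCompact hJ hX)
  · intro X Y f g h
    refine Sheaf.hom_ext ?_
    ext c x
    exact (sectionHom_comp_eq_iff x f g).1
      (h _ (isLocallyRepresentable_sheafify_yoneda J c.unop) _)


theorem isCoherentSubtopos_iff (J : GrothendieckTopology P) :
    IsCoherentSubtopos J ↔ GrothendieckTopology.IsFinitary J := by
  refine ⟨fun h => isFinitary_of_isCompactObject fun c => (h.2.2 _ ?_).1, fun h =>
    ⟨isCoherentTopos_presheaf, isCoherentTopos_sheaf h,
      fun F => isCoherentObject_presheafToSheaf h⟩⟩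
  exact isCoherentObject_yoneda c

end Semilattice

/-! ### Closed subtoposes and lower sets -/

section Closed

open Opposite

variable {P : Type u} [PartialOrder P]

/-- The topology of the closed complement of a lower set `U`. -/
def closedTopology (U : LowerSet P) : GrothendieckTopology P where
  sieves d := {S | d ∈ U ∨ S = ⊤}
  top_mem' _ := Or.inr rfl
  pullback_stable' c d S f := by
    rintro (h | rfl)
    · exact Or.inl (U.lower f.le h)
    · exact Or.inr Sieve.pullback_top
  transitive' c S hS R H := by
    rcases hS with h | rfl
    · exact Or.inl h
    · simpa using! H (f := 𝟙 c) trivial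

lemma closedTopology_isFinitary (U : LowerSet P) :
    GrothendieckTopology.IsFinitary (closedTopology U) := by
  rintro c S (hc | rfl)
  · exact ⟨∅, Set.finite_empty, by simp, Or.inl hc⟩
  · refine ⟨{⟨c, 𝟙 c⟩}, Set.finite_singleton _, by simp, Or.inr ?_⟩
    rw [← Sieve.id_mem_iff_eq_top]
    exact ⟨c, 𝟙 c, 𝟙 c, rfl, by simp⟩

/-- The lower set is recovered as the set of objects covered by the empty sieve. -/
lemma closedTopology_injective :
    Function.Injective (closedTopology : LowerSet P → GrothendieckTopology P) := by
  have key (U : LowerSet P) (d : P) : d ∈ U ↔ ⊥ ∈ closedTopology U d := by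
    refine (or_iff_left fun h => ?_).symm
    exact (Sieve.id_mem_iff_eq_top.2 h :)
  intro U V h
  ext d
  rw [SetLike.mem_coe, SetLike.mem_coe, key, key, h]

lemma isSheaf_closedTopology_iff (U : LowerSet P) (F : Pᵒᵖ ⥤ Type u) :
    Presheaf.IsSheaf (closedTopology U) F ↔ ∀ d ∈ U, Nonempty (Unique (F.obj (op d))) := by
  rw [isSheaf_iff_isSheaf_of_type]
  constructor
  · intro h d hd
    have hb := h (⊥ : Sieve d) (Or.inl hd)
    obtain ⟨x, -, hx⟩ := hb (fun _ _ h => h.elim) (fun _ _ _ _ _ _ _ h => h.elim)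
    exact ⟨⟨⟨x⟩, fun y => hx y fun _ _ h => h.elim⟩⟩
  · rintro h d S (hd | rfl)
    · intro x hx
      obtain ⟨hu⟩ := h d hd
      refine ⟨default, fun e f hf => ?_, fun y _ => Subsingleton.elim _ _⟩
      obtain ⟨hu'⟩ := h e (U.lower f.le hd)
      exact Subsingleton.elim _ _
    · exact Presieve.isSheafFor_top F

lemma isIso_prod_snd_iff {F U : Pᵒᵖ ⥤ Type u} (hU : IsSubterminal U) :
    IsIso (prod.snd : F ⨯ U ⟶ U) ↔
      ∀ d : P, Nonempty (U.obj (op d)) → Nonempty (Unique (F.obj (op d))) := by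
  rw [← FunctorToTypes.binaryProductIso_hom_comp_snd, isIso_comp_left_iff,
    NatTrans.isIso_iff_isIso_app]
  simp only [isIso_iff_bijective]
  have hs (d : P) : Subsingleton (U.obj (op d)) := by
    refine ⟨fun x y => yonedaEquiv.symm.injective (hU _ _)⟩
  constructor
  · rintro h d ⟨x⟩
    obtain ⟨⟨a, -⟩, -⟩ := (h (op d)).2 x
    refine ⟨⟨⟨a⟩, fun b => ?_⟩⟩
    exact congr_arg Prod.fst (@(h (op d)).1 (b, x) (a, x) rfl)
  · intro h d
    constructor
    · rintro ⟨a, x⟩ ⟨b, y⟩ hxy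
      obtain ⟨hu⟩ := h d.unop ⟨x⟩
      exact Prod.ext (hu.eq_default a |>.trans (hu.eq_default b).symm) hxy
    · intro x
      obtain ⟨hu⟩ := h d.unop ⟨x⟩
      exact ⟨(hu.default, x), rfl⟩

/-- The support of a presheaf on a poset. -/
def presheafSupport (F : Pᵒᵖ ⥤ Type u) : LowerSet P where
  carrier := {d | Nonempty (F.obj (op d))}
  lower' _ _ h := fun ⟨x⟩ => ⟨F.map (homOfLE h).op x⟩

/-- The subterminal presheaf supported on a lower set. -/
def lowerSetPresheaf (U : LowerSet P) : Pᵒᵖ ⥤ Type u where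
  obj d := ULift (PLift (d.unop ∈ U))
  map f := ↾fun x => ⟨⟨U.lower f.unop.le x.down.down⟩⟩

lemma isClosedSubtopos_iff (J : GrothendieckTopology P) :
    IsClosedSubtopos J ↔ ∃ U : LowerSet P, J = closedTopology U := by
  have key (U : Pᵒᵖ ⥤ Type u) (hU : IsSubterminal U) :
      (∀ F : Pᵒᵖ ⥤ Type u, Presheaf.IsSheaf J F ↔ IsIso (prod.snd : F ⨯ U ⟶ U)) ↔
        J = closedTopology (presheafSupport U) := by
    rw [topology_eq_iff_same_sheaves]
    refine forall_congr' fun F => ?_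
    rw [isIso_prod_snd_iff hU, ← isSheaf_iff_isSheaf_of_type, ← isSheaf_iff_isSheaf_of_type,
      isSheaf_closedTopology_iff]
    rfl
  constructor
  · rintro ⟨U, hU, h⟩
    exact ⟨_, (key U hU).1 h⟩
  · rintro ⟨U, rfl⟩
    have hU : IsSubterminal (lowerSetPresheaf U) := by
      intro F f g
      ext d x
      exact Subsingleton.elim (α := ULift (PLift _)) _ _
    refine ⟨lowerSetPresheaf U, hU, (key _ hU).2 (congr_arg _ ?_)⟩
    ext d
    exact ⟨fun h => ⟨⟨⟨h⟩⟩⟩, fun ⟨h⟩ => h.down.down⟩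

end Closed

/-! ### Topologies with enough points from sets of filters -/

section Points

open Opposite Order

variable {P : Type u} [PartialOrder P]

/-- The topology whose covering sieves meet every filter in `Y` that contains their vertex. -/
def filterTopology (Y : Set (PFilter P)) : GrothendieckTopology P where
  sieves d := {S | ∀ x ∈ Y, d ∈ x → ∃ e ∈ x, ∃ f : e ⟶ d, S f}
  top_mem' d := fun x _ hd => ⟨d, hd, 𝟙 d, trivial⟩
  pullback_stable' c d S f := by
    intro hS x hx hd
    obtain ⟨e, he, g, hg⟩ := hS x hx (PFilter.mem_of_le f.le hd)
    obtain ⟨e', he', h₁, h₂⟩ := x.directed e he d hd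
    refine ⟨e', he', homOfLE h₂, ?_⟩
    have : homOfLE h₂ ≫ f = homOfLE h₁ ≫ g := Subsingleton.elim _ _
    rw [Sieve.pullback_apply, this]
    exact S.downward_closed hg _
  transitive' c S hS R H := by
    intro x hx hc
    obtain ⟨e, he, f, hf⟩ := hS x hx hc
    obtain ⟨e', he', g, hg⟩ := H hf x hx he
    exact ⟨e', he', g ≫ f, hg⟩

lemma mem_filterTopology {Y : Set (PFilter P)} {d : P} (S : Sieve d) :
    S ∈ filterTopology Y d ↔ ∀ x ∈ Y, d ∈ x → ∃ e ∈ x, ∃ f : e ⟶ d, S f := Iff.rfl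

/-- The functor that indicates membership in a filter. -/
def filterFiber (x : PFilter P) : P ⥤ Type u where
  obj c := ULift (PLift (c ∈ x))
  map f := ↾fun h => ⟨⟨PFilter.mem_of_le f.le h.down.down⟩⟩

instance (x : PFilter P) : IsCofiltered (filterFiber x).Elements where
  nonempty := by
    obtain ⟨c, hc⟩ := x.nonempty
    exact ⟨⟨c, ⟨⟨hc⟩⟩⟩⟩
  cone_objs := by
    rintro ⟨a, ⟨⟨ha⟩⟩⟩ ⟨b, ⟨⟨hb⟩⟩⟩
    obtain ⟨c, hc, h₁, h₂⟩ := x.directed a ha b hb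
    exact ⟨⟨c, ⟨⟨hc⟩⟩⟩, ⟨homOfLE h₁, rfl⟩, ⟨homOfLE h₂, rfl⟩, trivial⟩
  cone_maps a b f g := ⟨a, 𝟙 a, by
    congr 1
    exact Subtype.ext (Subsingleton.elim _ _)⟩

/-- The point of `filterTopology Y` given by a member of `Y`. -/
def filterPoint {Y : Set (PFilter P)} (x : Y) :
    GrothendieckTopology.Point.{u} (filterTopology Y) where
  fiber := filterFiber x.1
  initiallySmall := InitiallySmall.mk' (𝟭 _)
  jointly_surjective R hR := by
    rintro ⟨⟨h⟩⟩
    obtain ⟨e, he, f, hf⟩ := hR x.1 x.2 h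
    exact ⟨e, f, hf, ⟨⟨he⟩⟩, rfl⟩

lemma hasEnoughPoints_filterTopology (Y : Set (PFilter P)) :
    GrothendieckTopology.HasEnoughPoints.{u} (filterTopology Y) where
  exists_objectProperty := by
    refine ⟨ObjectProperty.ofObj (filterPoint (Y := Y)), inferInstance,
      ObjectProperty.IsConservativeFamilyOfPoints.mk' fun c S H x hx hc => ?_⟩
    obtain ⟨e, f, hf, ⟨⟨he⟩⟩, -⟩ := H
      ⟨filterPoint ⟨x, hx⟩, ObjectProperty.ofObj_apply _ _⟩ (ULift.up (PLift.up hc))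
    exact ⟨e, he, f, hf⟩

/-- The elements outside `φ i` form a sieve on `⊤`. A filter misses it only if contained in `φ i`,
so by the antichain condition it covers exactly when `i ∉ Y`. -/
lemma filterTopology_image_injective [OrderTop P] {ι : Type*} (φ : ι → PFilter P)
    (hφ : ∀ i j, φ i ≤ φ j → i = j) :
    Function.Injective fun Y : Set ι => filterTopology (φ '' Y) := by
  let S (i : ι) : Sieve (⊤ : P) :=
    { arrows e _ := e ∉ φ i
      downward_closed h g h' := h (PFilter.mem_of_le g.le h') }
  have key (i : ι) (Y : Set ι) : i ∉ Y ↔ S i ∈ filterTopology (φ '' Y) ⊤ := by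
    rw [mem_filterTopology, Set.forall_mem_image]
    constructor
    · intro hi j hj _
      obtain ⟨e, he, he'⟩ := SetLike.not_le_iff_exists.1 fun h => hi (hφ j i h ▸ hj)
      exact ⟨e, he, homOfLE le_top, he'⟩
    · intro h hi
      obtain ⟨e, he, f, hne⟩ := h hi PFilter.top_mem
      exact hne he
  intro Y Z h
  ext i
  rw [← not_iff_not, key, key]
  exact iff_of_eq (congr_arg (fun J => S i ∈ J ⊤) h)

end Points

/-! ### Upper bounds over a countable poset -/

section Counting

variable {P : Type} [PartialOrder P]

lemma mk_lowerSet_le [Countable P] : #(LowerSet P) ≤ 2 ^ ℵ₀ := by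
  refine (Cardinal.mk_le_of_injective (SetLike.coe_injective (A := LowerSet P))).trans ?_
  rw [Cardinal.mk_set]
  exact Cardinal.power_le_power_left two_ne_zero Cardinal.mk_le_aleph0

lemma mk_isFinitary_le [Countable P] :
    #{J : GrothendieckTopology P // GrothendieckTopology.IsFinitary J} ≤ 2 ^ ℵ₀ := by
  let T := Σ c : P, Finset (Σ d : P, d ⟶ c)
  let gen (t : T) : Sieve t.1 := Sieve.generate fun d g => ⟨d, g⟩ ∈ t.2
  let F (J : {J : GrothendieckTopology P // GrothendieckTopology.IsFinitary J}) : Set T :=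
    {t | gen t ∈ J.1 t.1}
  have hle (J K) (h : F J ⊆ F K) : J ≤ K := by
    intro c S hS
    obtain ⟨s, hs, hsS, hsJ⟩ := J.2 S hS
    lift s to Finset (Σ d : P, d ⟶ c) using hs
    have : (⟨c, s⟩ : T) ∈ F K := h hsJ
    refine K.1.superset_covering ?_ this
    rw [Sieve.generate_le_iff]
    exact fun d g hg => hsS _ hg
  have hF : Function.Injective F := fun J K h => le_antisymm (hle _ _ h.le) (hle _ _ h.ge)
  refine (Cardinal.mk_le_of_injective hF).trans ?_
  rw [Cardinal.mk_set]
  exact Cardinal.power_le_power_left two_ne_zero Cardinal.mk_le_aleph0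

lemma mk_grothendieckTopology_le [Countable P] :
    #(GrothendieckTopology P) ≤ 2 ^ ((2 : Cardinal.{0}) ^ ℵ₀) := by
  have h₁ : #(Σ c : P, Sieve c) ≤ 2 ^ ℵ₀ := by
    have hinj : Function.Injective fun S : Σ c : P, Sieve c =>
        (S.1, {e | ∃ f : e ⟶ S.1, S.2 f}) := by
      rintro ⟨c, S⟩ ⟨d, R⟩ h
      obtain ⟨rfl, h⟩ := Prod.mk.inj h
      have (T : Sieve c) (e : P) (f : e ⟶ c) : T f ↔ e ∈ {e | ∃ f : e ⟶ c, T f} :=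
        ⟨fun h => ⟨f, h⟩, fun ⟨g, hg⟩ => by rwa [Subsingleton.elim f g]⟩
      congr 1
      ext e f
      rw [this, this, h]
    refine (Cardinal.mk_le_of_injective hinj).trans ?_
    rw [Cardinal.mk_prod, Cardinal.mk_set, Cardinal.lift_id, Cardinal.lift_id]
    refine (mul_le_mul' (Cardinal.mk_le_aleph0.trans (Cardinal.cantor ℵ₀).le)
      (Cardinal.power_le_power_left two_ne_zero Cardinal.mk_le_aleph0)).trans ?_
    rw [Cardinal.mul_eq_self (Cardinal.cantor ℵ₀).le]
  have hinj : Function.Injective fun J : GrothendieckTopology P =>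
      {S : Σ c : P, Sieve c | S.2 ∈ J S.1} := by
    intro J K h
    ext c S
    exact Set.ext_iff.1 h ⟨c, S⟩
  refine (Cardinal.mk_le_of_injective hinj).trans ?_
  rw [Cardinal.mk_set]
  exact Cardinal.power_le_power_left two_ne_zero h₁

end Counting

/-! ### Exponents of positive integers -/

section BigCell

open Order

namespace BigCell

lemma le_iff {m n : BigCell} : m ≤ n ↔ (n.val : ℕ) ∣ m.val := PNat.dvd_iff

instance : SemilatticeInf BigCell where
  inf m n := ⟨PNat.lcm m.val n.val⟩
  inf_le_left m n := PNat.dvd_lcm_left m.val n.val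
  inf_le_right m n := PNat.dvd_lcm_right m.val n.val
  le_inf _ _ _ h₁ h₂ := PNat.lcm_dvd h₁ h₂

instance : OrderTop BigCell where
  top := ⟨1⟩
  le_top n := one_dvd n.val

instance : Countable BigCell :=
  Function.Injective.countable (f := BigCell.val) fun _ _ => BigCell.ext

/-- The exponent of a prime in a positive integer. -/
def exponent (n : BigCell) (q : Nat.Primes) : ℕ := padicValNat q n.val

lemma le_iff_exponent_le {m n : BigCell} : m ≤ n ↔ ∀ q, n.exponent q ≤ m.exponent q := by
  rw [le_iff, ← Nat.factorization_le_iff_dvd n.val.ne_zero m.val.ne_zero]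
  constructor
  · intro h q
    simpa [exponent, Nat.factorization_def _ q.2] using h q
  · intro h q
    by_cases hq : q.Prime
    · simpa [exponent, Nat.factorization_def _ hq] using h ⟨q, hq⟩
    · simp [Nat.factorization_eq_zero_of_not_prime _ hq]

lemma exponent_inf (m n : BigCell) (q : Nat.Primes) :
    (m ⊓ n).exponent q = max (m.exponent q) (n.exponent q) := by
  change padicValNat q (PNat.lcm m.val n.val : ℕ+) = _
  rw [PNat.lcm_coe, exponent, exponent, ← Nat.factorization_def _ q.2,
    Nat.factorization_lcm m.val.ne_zero n.val.ne_zero, Finsupp.sup_apply,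
    Nat.factorization_def _ q.2, Nat.factorization_def _ q.2]

lemma exponent_top (q : Nat.Primes) : (⊤ : BigCell).exponent q = 0 := by
  change padicValNat q ((1 : ℕ+) : ℕ) = 0
  simp

lemma exponent_eq_zero_of_not_dvd {n : BigCell} {q : Nat.Primes} (h : ¬ (q : ℕ) ∣ n.val) :
    n.exponent q = 0 :=
  padicValNat.eq_zero_of_not_dvd h

/-- The power of a prime. -/
def primePow (q : Nat.Primes) (k : ℕ) : BigCell := ⟨⟨(q : ℕ) ^ k, pow_pos q.2.pos k⟩⟩

lemma exponent_primePow (q r : Nat.Primes) (k : ℕ) :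
    (primePow q k).exponent r = if r = q then k else 0 := by
  change padicValNat r ((q : ℕ) ^ k) = _
  rw [← Nat.factorization_def _ r.2, q.2.factorization_pow, Finsupp.single_apply]
  simp only [Nat.Primes.coe_nat_inj, eq_comm]

end BigCell

/-! ### Filters as supernatural numbers -/

/-- The filter of the positive integers that divide a supernatural number. -/
def Supernatural.toPFilter (s : Supernatural) : PFilter BigCell :=
  IsPFilter.toPFilter (F := {n | ∀ q, (n.exponent q : ℕ∞) ≤ s q}) <| .of_def
    ⟨⊤, fun q => by simp [BigCell.exponent_top]⟩
    (fun m hm n hn => ⟨m ⊓ n, fun q => by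
      rw [BigCell.exponent_inf]
      rcases max_choice (m.exponent q) (n.exponent q) with h | h <;> rw [h]
      exacts [hm q, hn q], inf_le_left, inf_le_right⟩)
    (fun h hm q => (Nat.cast_le.2 (BigCell.le_iff_exponent_le.1 h q)).trans (hm q))

lemma Supernatural.mem_toPFilter {s : Supernatural} {n : BigCell} :
    n ∈ s.toPFilter ↔ ∀ q, (n.exponent q : ℕ∞) ≤ s q := Iff.rfl

/-- The least common multiple, as a supernatural number, of the members of a filter. -/
noncomputable def pfilterExponent (F : PFilter BigCell) : Supernatural :=
  fun q => ⨆ n : F, (n.1.exponent q : ℕ∞)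

/-- A natural number below a supremum of naturals is below one of them. So each prime dividing `n`
has a witness in `F`, and the meet (least common multiple) of these finitely many witnesses is a
multiple of `n`. -/
lemma mem_iff_exponent_le {F : PFilter BigCell} {n : BigCell} :
    n ∈ F ↔ ∀ q, (n.exponent q : ℕ∞) ≤ pfilterExponent F q := by
  refine ⟨fun h q => le_iSup (fun n : F => (n.1.exponent q : ℕ∞)) ⟨n, h⟩, fun h => ?_⟩
  have hex (q : Nat.Primes) : ∃ m ∈ F, n.exponent q ≤ m.exponent q := by
    by_contra! hlt
    -- Positivity makes the truncated subtraction `n.exponent q - 1` a strictly smaller bound.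
    have hpos : 0 < n.exponent q := (Nat.zero_le _).trans_lt (hlt ⊤ PFilter.top_mem)
    have : pfilterExponent F q ≤ (n.exponent q - 1 : ℕ) :=
      iSup_le fun m => Nat.cast_le.2 (Nat.le_sub_one_of_lt (hlt m.1 m.2))
    have := Nat.cast_le.1 ((h q).trans this)
    omega
  choose m hm hmn using hex
  have hfin : {q : Nat.Primes | (q : ℕ) ∣ n.val}.Finite :=
    Set.Finite.preimage Nat.Primes.coe_nat_injective.injOn
      (Set.finite_le_nat (n.val : ℕ)) |>.subset fun q hq => Nat.le_of_dvd n.val.pos hq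
  have hinf (t : Finset Nat.Primes) : t.inf m ∈ F := by
    classical
    induction t using Finset.induction_on with
    | empty => exact PFilter.top_mem
    | insert q t _ ih =>
      rw [Finset.inf_insert]
      exact PFilter.inf_mem (hm q) ih
  refine PFilter.mem_of_le (BigCell.le_iff_exponent_le.2 fun q => ?_) (hinf hfin.toFinset)
  by_cases hq : (q : ℕ) ∣ n.val
  · exact (hmn q).trans (BigCell.le_iff_exponent_le.1 (Finset.inf_le (hfin.mem_toFinset.2 hq)) q)
  · simp [BigCell.exponent_eq_zero_of_not_dvd hq]

/-- Filters on the big cell are supernatural numbers. -/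
noncomputable def pfilterEquivSupernatural : PFilter BigCell ≃o Supernatural where
  toFun := pfilterExponent
  invFun := Supernatural.toPFilter
  left_inv F := by
    ext n
    exact mem_iff_exponent_le.symm
  right_inv s := by
    funext q
    refine le_antisymm (iSup_le fun n => n.2 q) ?_
    -- An infinite exponent is reached through its finite lower bounds, each realized by a prime
    -- power in the filter.
    refine ENat.forall_natCast_le_iff_le.1 fun k hk => ?_
    have hmem : BigCell.primePow q k ∈ s.toPFilter := by
      rw [Supernatural.mem_toPFilter]
      intro r
      rw [BigCell.exponent_primePow]
      split_ifs with h
      · rwa [h]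
      · simp
    simpa [BigCell.exponent_primePow] using mem_iff_exponent_le.1 hmem q
  map_rel_iff' {F G} := by
    constructor
    · intro h n hn
      exact mem_iff_exponent_le.2 fun q => (mem_iff_exponent_le.1 hn q).trans (h q)
    · intro h q
      exact iSup_le fun n => mem_iff_exponent_le.1 (h n.2) q

lemma pfilterEquivSupernatural_principal (n : BigCell) (q : Nat.Primes) :
    pfilterEquivSupernatural (PFilter.principal n) q = (padicValNat (q : ℕ) (n.val : ℕ) : ℕ∞) := by
  refine le_antisymm (iSup_le fun m => ?_) ?_
  · exact Nat.cast_le.2 (BigCell.le_iff_exponent_le.1 (PFilter.mem_principal.1 m.2) q)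
  · exact mem_iff_exponent_le.1 (PFilter.mem_principal.2 le_rfl) q

/-! ### The cardinalities for the big cell -/

lemma mk_primes : #Nat.Primes = ℵ₀ := Cardinal.mk_eq_aleph0 _

lemma mk_supernatural : #Supernatural = 2 ^ ℵ₀ := by
  have : #ℕ∞ = ℵ₀ := Cardinal.mk_eq_aleph0 _
  rw [← Cardinal.power_def, mk_primes, this, Cardinal.power_self_eq le_rfl]

/-- For the lower bound, a set of primes is recovered from the lower set of its multiples as the
primes lying in it. -/
lemma mk_lowerSet_bigCell : #(LowerSet BigCell) = 2 ^ ℵ₀ := by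
  refine mk_lowerSet_le.antisymm ?_
  rw [← mk_primes, ← Cardinal.mk_set]
  refine Cardinal.mk_le_of_injective (f := fun S : Set Nat.Primes =>
    (⟨{n | ∃ q ∈ S, (q : ℕ) ∣ n.val},
      fun _ _ h ⟨q, hq, hd⟩ => ⟨q, hq, hd.trans (BigCell.le_iff.1 h)⟩⟩ : LowerSet BigCell)) ?_
  have key (S : Set Nat.Primes) (q : Nat.Primes) :
      q ∈ S ↔ BigCell.primePow q 1 ∈ {n : BigCell | ∃ q ∈ S, (q : ℕ) ∣ n.val} := by
    refine ⟨fun h => ⟨q, h, by simp [BigCell.primePow]⟩, ?_⟩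
    rintro ⟨r, hr, hd⟩
    have : (r : ℕ) ∣ q := by simpa [BigCell.primePow] using hd
    rwa [← (Nat.Primes.coe_nat_inj _ _).1 ((Nat.prime_dvd_prime_iff_eq r.2 q.2).1 this)]
  intro S T h
  ext q
  rw [key, key]
  exact iff_of_eq (congr_arg (fun U : LowerSet BigCell => BigCell.primePow q 1 ∈ U) h)

lemma mk_closedSubtopos : #{J : GrothendieckTopology BigCell // IsClosedSubtopos J} = 2 ^ ℵ₀ := by
  rw [← mk_lowerSet_bigCell, ← Cardinal.mk_range_eq _ closedTopology_injective]
  refine Cardinal.mk_congr (Equiv.subtypeEquivRight fun J => ?_)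
  rw [isClosedSubtopos_iff, Set.mem_range]
  simp only [eq_comm]

lemma mk_coherentSubtopos :
    #{J : GrothendieckTopology BigCell // IsCoherentSubtopos J} = 2 ^ ℵ₀ := by
  simp only [isCoherentSubtopos_iff]
  refine mk_isFinitary_le.antisymm ?_
  rw [← mk_lowerSet_bigCell]
  exact Cardinal.mk_le_of_injective
    (f := fun U => ⟨closedTopology U, closedTopology_isFinitary U⟩)
    fun U V h => closedTopology_injective (congr_arg Subtype.val h)

/-- Label the primes by pairs in `ℕ × Bool` and send `A` to the squarefree product of the primes
labelled `(n, decide (n ∈ A))`. This is the graph of an indicator function, and one graph contained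
in another equals it. -/
lemma exists_antichain_pfilter :
    ∃ φ : Set ℕ → PFilter BigCell, ∀ A B, φ A ≤ φ B → A = B := by
  classical
  obtain ⟨e⟩ : Nonempty (Nat.Primes ≃ ℕ × Bool) :=
    Cardinal.eq.1 (mk_primes.trans (Cardinal.mk_eq_aleph0 _).symm)
  let s (A : Set ℕ) : Supernatural := fun q => if decide ((e q).1 ∈ A) = (e q).2 then 1 else 0
  refine ⟨fun A => pfilterEquivSupernatural.symm (s A), fun A B h => ?_⟩
  have h' : s A ≤ s B := pfilterEquivSupernatural.symm.le_iff_le.1 h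
  ext n
  have := h' (e.symm (n, decide (n ∈ A)))
  by_contra hn
  rw [show s A (e.symm (n, decide (n ∈ A))) = 1 by simp [s],
    show s B (e.symm (n, decide (n ∈ A))) = 0 by simp [s, iff_comm, hn]] at this
  exact one_ne_zero (nonpos_iff_eq_zero.1 this)

lemma two_power_le_mk_hasEnoughPoints : 2 ^ ((2 : Cardinal.{0}) ^ ℵ₀) ≤
    #{J : GrothendieckTopology BigCell // GrothendieckTopology.HasEnoughPoints.{0} J} := by
  obtain ⟨φ, hφ⟩ := exists_antichain_pfilter
  rw [← Cardinal.mk_nat, ← Cardinal.mk_set, ← Cardinal.mk_set]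
  exact Cardinal.mk_le_of_injective
    (f := fun Y : Set (Set ℕ) => ⟨filterTopology (φ '' Y), hasEnoughPoints_filterTopology _⟩)
    fun Y Z h => filterTopology_image_injective φ hφ (congr_arg Subtype.val h)

end BigCell

theorem mainTheorem9 :
    (∃ e : Order.PFilter BigCell ≃o Supernatural, ∀ (n : BigCell) (q : Nat.Primes),
      e (Order.PFilter.principal n) q = (padicValNat (q : ℕ) (n.val : ℕ) : ℕ∞)) ∧
    #(Order.PFilter BigCell) = 2 ^ ℵ₀ ∧
    #{J : GrothendieckTopology BigCell // IsClosedSubtopos J} = 2 ^ ℵ₀ ∧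
    #{J : GrothendieckTopology BigCell // IsCoherentSubtopos J} = 2 ^ ℵ₀ ∧
    #{J : GrothendieckTopology BigCell //
        GrothendieckTopology.HasEnoughPoints.{0} J} = 2 ^ ((2 : Cardinal.{0}) ^ ℵ₀) ∧
    #(GrothendieckTopology BigCell) = 2 ^ ((2 : Cardinal.{0}) ^ ℵ₀) := by
  refine ⟨⟨pfilterEquivSupernatural, pfilterEquivSupernatural_principal⟩,
    (Cardinal.mk_congr pfilterEquivSupernatural.toEquiv).trans mk_supernatural,
    mk_closedSubtopos, mk_coherentSubtopos,
    ((Cardinal.mk_subtype_le _).trans mk_grothendieckTopology_le).antisymm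
      two_power_le_mk_hasEnoughPoints,
    mk_grothendieckTopology_le.antisymm
      (two_power_le_mk_hasEnoughPoints.trans (Cardinal.mk_subtype_le _))⟩
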